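/- Let $A$ be a finite set of agents and $O$ a finite set of indivisible objects. Each agent $i\in A$ has a nonempty endowment $\omega_i\subseteq O$, where the sets $\omega_i$ are pairwise disjoint with $\bigcup_{i\in A}\omega_i=O$, and a utility function $v_i:2^O\to\mathbb{R}\cup\{-\infty\}$. Suppose that preferences are dichotomous over items: for each agent $i$ there is a set $G_i\subseteq O$ of acceptable objects such that $v_i(X)=|X\cap G_i|$ for every $X\subseteq O$. Then the weak core of this economy is nonempty. That is, there is an allocation $(X_i)_{i\in A}$ (pairwise disjoint subsets of $O$, not necessarily exhausting $O$) such that there are no nonempty coalition $S\subseteq A$ and pairwise disjoint sets $(Y_i)_{i\in S}$ with $\bigcup_{i\in S}Y_i\subseteq\bigcup_{i\in S}\omega_i$ and $v_i(Y_i)>v_i(X_i)$ for all $i\in S$. -/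

import Mathlib

/-- An exchange economy with indivisible goods, with agents `A` and objects `O` (both are taken
finite in results about economies). Agent `i` has a utility over bundles with values in
`ℝ ∪ {-∞}` and a nonempty endowment; the endowments partition the objects. -/
structure Economy (A O : Type*) where
  /-- the utility functions -/
  utility : A → Finset O → WithBot ℝ
  /-- the endowments -/
  endowment : A → Finset O
  endowment_nonempty : ∀ i, (endowment i).Nonempty
  endowment_disjoint : ∀ i j, i ≠ j → Disjoint (endowment i) (endowment j)
  endowment_cover : ∀ o, ∃ i, o ∈ endowment i

namespace Economy

variable {A O : Type*}

/-- An allocation: pairwise disjoint bundles, one for each agent. Objects may remain unassigned. -/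
def IsAllocation (_E : Economy A O) (X : A → Finset O) : Prop :=
  ∀ i j, i ≠ j → Disjoint (X i) (X j)

/-- An `S`-allocation: pairwise disjoint bundles, one for each member of `S`, made up of objects
that members of `S` are endowed with. -/
def IsCoalitionAllocation (E : Economy A O) (S : Finset A) (Y : S → Finset O) : Prop :=
  (∀ i j, i ≠ j → Disjoint (Y i) (Y j)) ∧
    ∀ i, ∀ o ∈ Y i, ∃ j ∈ S, o ∈ E.endowment j

/-- The set `S` of agents strongly blocks `X`: some `S`-allocation makes every member of `S`
strictly better off. -/
def StronglyBlocks (E : Economy A O) (S : Finset A) (X : A → Finset O) : Prop :=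
  ∃ Y : S → Finset O, E.IsCoalitionAllocation S Y ∧
    ∀ i : S, E.utility i (X i) < E.utility i (Y i)

/-- The weak core: the allocations that no coalition (nonempty set of agents) strongly blocks. -/
def weakCore (E : Economy A O) : Set (A → Finset O) :=
  {X | E.IsAllocation X ∧ ∀ S : Finset A, S.Nonempty → ¬ E.StronglyBlocks S X}

/-- Dichotomous item preferences: each agent `i` has a set `G` of acceptable objects, and values a
bundle by the number of acceptable objects that it contains. -/
def HasDichotomousItemPreferences [DecidableEq O] (E : Economy A O) : Prop :=
  ∀ i, ∃ G : Finset O, ∀ X : Finset O,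
    E.utility i X = (((X ∩ G).card : ℝ) : WithBot ℝ)

end Economy

/-! Scarf's argument for balanced games, followed by integrality of bipartite matching. The columns
are all pairs of a coalition and an allocation of its endowments, plus one slack column per agent
(standing alone with nothing). Scarf's lemma (`exists_isFeasible_isDominating`) gives a set `D` of
columns that dominates every column and carries positive weights under which each agent is covered
with total weight close to 1.

Let `u i` be the least utility that agent `i` gets in the members of `D` containing `i`. Domination
says that no coalition can give every member more than `u`. It remains to realize `u` by one
allocation. Averaging the allocations in `D` with the weights provides `u` fractionally, which is
Hall's condition for giving each `i` exactly `u i` acceptable objects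
(`exists_disjoint_subsets_card_eq`). Dichotomous preferences enter here: utilities count objects, so
a fractional assignment can be rounded.

Scarf's lemma is proved for a generic right-hand side only. The weights therefore sum to slightly
less than 1, an error that integrality absorbs. -/

/-! ### Scarf's lemma -/

/-- A set `D` of columns is dominating for the rankings `r i` if each column is ranked weakly below
all members of `D` in at least one row. -/
def IsDominating {I J : Type*} (r : I → J → ℕ) (D : Finset J) : Prop :=
  ∀ k, ∃ i, ∀ d ∈ D, r i k ≤ r i d

/-- `b` is a combination of the columns of `a` whose coefficients are positive on `F` and vanish
elsewhere. -/
def IsFeasible {I J : Type*} [Fintype J] (a : J → I → ℝ) (b : I → ℝ) (F : Finset J) : Prop :=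
  ∃ x : J → ℝ, (∀ j ∈ F, 0 < x j) ∧ (∀ j ∉ F, x j = 0) ∧ ∑ j, x j • a j = b

theorem IsDominating.mono {I J : Type*} {r : I → J → ℕ} {D E : Finset J} (h : IsDominating r D) (hE : E ⊆ D) :
    IsDominating r E := fun k => (h k).imp fun _ hi d hd => hi d (hE hd)

/-! ### Ordinal and cardinal pivoting -/

section Scarf

variable {I J : Type*} [Fintype I] [Fintype J] [DecidableEq J]

/-- Replacing a repeated row minimum of `E`: there is exactly one column that becomes the new
minimum in row `i₁` and completes `E` to a dominating set. -/
theorem existsUnique_insert_isDominating {r : I → J → ℕ} (hr : ∀ i, Function.Injective (r i))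
    {E : Finset J} (hdom : IsDominating r E) {m : I → J} (hmE : ∀ i, m i ∈ E)
    (hmin : ∀ i, ∀ d ∈ E, r i (m i) ≤ r i d) {i₁ : I}
    (hinj : ∀ i j, i ≠ i₁ → j ≠ i₁ → m i = m j → i = j)
    (hsurj : ∀ d ∈ E, ∃ i, i ≠ i₁ ∧ m i = d)
    (hq : ∃ q, ∀ i, i ≠ i₁ → ∃ d ∈ E, r i d < r i q) :
    ∃ k₁, ∀ k, (k ∉ E ∧ IsDominating r (insert k E) ∧ r i₁ k < r i₁ (m i₁)) ↔ k = k₁ := by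
  classical
  -- Only columns of `Q` can enter without displacing a minimum in a row other than `i₁`. The one
  -- ranked highest in row `i₁` is forced, since a higher one would be left undominated.
  let Q : Finset J := Finset.univ.filter fun k => ∀ i, i ≠ i₁ → r i (m i) < r i k
  have hQ : ∀ k, k ∈ Q ↔ ∀ i, i ≠ i₁ → r i (m i) < r i k := fun k => by simp [Q]
  have hQne : Q.Nonempty := by
    obtain ⟨q, hq⟩ := hq
    refine ⟨q, (hQ q).2 fun i hi => ?_⟩
    obtain ⟨d, hd, hlt⟩ := hq i hi
    exact (hmin i d hd).trans_lt hlt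
  obtain ⟨k₁, hk₁, hmax⟩ := Q.exists_max_image (r i₁) hQne
  rw [hQ] at hk₁
  have hk₁E : k₁ ∉ E := fun h => by
    obtain ⟨i, hi, rfl⟩ := hsurj _ h
    exact lt_irrefl _ (hk₁ i hi)
  have hlt : r i₁ k₁ < r i₁ (m i₁) := by
    obtain ⟨i, hi⟩ := hdom k₁
    have h1 := hi _ (hmE i)
    have : i = i₁ := by
      by_contra h
      exact absurd (hk₁ i h) (not_lt.2 h1)
    subst this
    exact lt_of_le_of_ne h1 fun h => hk₁E (hr _ h ▸ hmE _)
  refine ⟨k₁, fun k => ⟨?_, ?_⟩⟩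
  · rintro ⟨hkE, hkd, hkl⟩
    have hkQ : k ∈ Q := (hQ k).2 fun i hi => by
      obtain ⟨i', hi'⟩ := hkd (m i)
      have h1 : m i' = m i := hr i' (le_antisymm (hmin i' _ (hmE i))
        (hi' _ (Finset.mem_insert_of_mem (hmE i'))))
      have h2 : r i' (m i) ≤ r i' k := hi' _ (Finset.mem_insert_self _ _)
      have h3 : i' ≠ i₁ := by
        rintro rfl
        rw [← h1] at h2
        exact absurd hkl (not_lt.2 h2)
      obtain rfl := hinj _ _ h3 hi h1
      exact lt_of_le_of_ne h2 fun h => hkE (hr _ h ▸ hmE _)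
    have hle := hmax k hkQ
    obtain ⟨i, hi⟩ := hkd k₁
    have : i = i₁ := by
      by_contra h
      exact absurd (hk₁ i h) (not_lt.2 (hi _ (Finset.mem_insert_of_mem (hmE i))))
    subst this
    exact hr _ (le_antisymm hle (hi _ (Finset.mem_insert_self _ _)))
  · rintro rfl
    refine ⟨hk₁E, fun k' => ?_, hlt⟩
    by_cases hk' : k' ∈ Q
    · refine ⟨i₁, fun d hd => (hmax k' hk').trans ?_⟩
      rcases Finset.mem_insert.1 hd with rfl | hd
      · exact le_rfl
      · exact hlt.le.trans (hmin _ _ hd)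
    · rw [hQ] at hk'
      push Not at hk'
      obtain ⟨i, hi, hle⟩ := hk'
      refine ⟨i, fun d hd => hle.trans ?_⟩
      rcases Finset.mem_insert.1 hd with rfl | hd
      · exact (hk₁ i hi).le
      · exact hmin _ _ hd

open Classical in
/-- Ordinal pivoting: a set with one column too few has zero or two completions to a dominating
set. -/
theorem even_card_insert_isDominating {r : I → J → ℕ} (hr : ∀ i, Function.Injective (r i))
    {E : Finset J} (hne : E.Nonempty) (hcard : E.card + 1 = Fintype.card I)
    (hq : ∀ i₁, ∃ q, ∀ i, i ≠ i₁ → ∃ d ∈ E, r i d < r i q) :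
    Even (Finset.univ.filter fun k => k ∉ E ∧ IsDominating r (insert k E)).card := by
  by_cases hex : ∃ k, k ∉ E ∧ IsDominating r (insert k E)
  swap
  · push Not at hex
    rw [Finset.filter_false_of_mem (by simpa using hex)]
    simp
  obtain ⟨k₀, hk₀, hd₀⟩ := hex
  have hdom : IsDominating r E := hd₀.mono (Finset.subset_insert _ _)
  choose m hmE hmin using fun i => E.exists_min_image (r i) hne
  have hm : ∀ {D : Finset J} {i d}, E ⊆ D → d ∈ E → (∀ e ∈ D, r i d ≤ r i e) → m i = d :=
    fun hD hd h => hr _ (le_antisymm (hmin _ _ hd) (h _ (hD (hmE _))))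
  -- The row in which `d` itself is dominated has `d` as its minimum. So `m` maps `n` rows onto `n -
  -- 1` columns, and exactly one pair of rows `i₁`, `i₂` shares a minimum.
  have hsurj : ∀ d ∈ E, ∃ i, m i = d := fun d hd => by
    obtain ⟨i, hi⟩ := hdom d
    exact ⟨i, hm subset_rfl hd hi⟩
  obtain ⟨i₁, -, i₂, -, hi, hmi⟩ := Finset.exists_ne_map_eq_of_card_lt_of_maps_to
    (s := (Finset.univ : Finset I)) (t := E) (by rw [Finset.card_univ]; omega) (f := m)
    (fun i _ => hmE i)
  have key : ∀ i₁ i₂, i₁ ≠ i₂ → m i₁ = m i₂ → (∀ d ∈ E, ∃ i, i ≠ i₁ ∧ m i = d) ∧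
      ∀ i j, i ≠ i₁ → j ≠ i₁ → m i = m j → i = j := by
    intro i₁ i₂ hi hmi
    have hs : ∀ d ∈ E, ∃ i, i ≠ i₁ ∧ m i = d := fun d hd => by
      obtain ⟨i, rfl⟩ := hsurj d hd
      by_cases h : i = i₁
      · exact ⟨i₂, hi.symm, by rw [h, hmi]⟩
      · exact ⟨i, h, rfl⟩
    refine ⟨hs, fun i j hi hj hij => ?_⟩
    have himg : (Finset.univ.erase i₁).image m = E := by
      ext d
      simp only [Finset.mem_image, Finset.mem_erase, Finset.mem_univ, and_true]
      exact ⟨fun ⟨i, _, h⟩ => h ▸ hmE i, hs d⟩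
    have hinj := Finset.injOn_of_card_image_eq (s := Finset.univ.erase i₁) (f := m) (by
      rw [himg, Finset.card_erase_of_mem (Finset.mem_univ _), Finset.card_univ]; omega)
    exact hinj (by simpa using hi) (by simpa using hj) hij
  obtain ⟨hs₁, hj₁⟩ := key i₁ i₂ hi hmi
  obtain ⟨hs₂, hj₂⟩ := key i₂ i₁ hi.symm hmi.symm
  obtain ⟨k₁, hk₁⟩ := existsUnique_insert_isDominating hr hdom hmE hmin hj₁ hs₁ (hq i₁)
  obtain ⟨k₂, hk₂⟩ := existsUnique_insert_isDominating hr hdom hmE hmin hj₂ hs₂ (hq i₂)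
  -- A completing column lowers the minimum in exactly one of the rows `i₁`, `i₂`. If it lowered
  -- another row's minimum only, that old minimum would be undominated; if it lowered both, the
  -- shared minimum would be.
  have hor : ∀ k, k ∉ E → IsDominating r (insert k E) →
      r i₁ k < r i₁ (m i₁) ∨ r i₂ k < r i₂ (m i₂) := by
    intro k _ hd
    by_contra! hcon
    obtain ⟨i, hik⟩ := hd k
    obtain ⟨i', hi'⟩ := hd (m i)
    have h1 : m i' = m i := hm (Finset.subset_insert _ _) (hmE i) hi'
    by_cases hii : i' = i
    · subst hii
      have h2 : r i' (m i') = r i' k := le_antisymm (hi' _ (Finset.mem_insert_self _ _))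
        (hik _ (Finset.mem_insert_of_mem (hmE i')))
      exact ‹k ∉ E› (hr _ h2 ▸ hmE i')
    · have hne : ∀ j, r j (m j) ≤ r j k → i ≠ j := by
        rintro j hj rfl
        have h2 := hr _ (le_antisymm hj (hik _ (Finset.mem_insert_of_mem (hmE i))))
        exact ‹k ∉ E› (h2 ▸ hmE i)
      have e1 : i' = i₁ := by
        by_contra h
        exact hii (hj₁ _ _ h (hne _ hcon.1) h1)
      have e2 : i' = i₂ := by
        by_contra h
        exact hii (hj₂ _ _ h (hne _ hcon.2) h1)
      exact hi (e1.symm.trans e2)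
  have hnot : ∀ k, IsDominating r (insert k E) → r i₁ k < r i₁ (m i₁) →
      ¬ r i₂ k < r i₂ (m i₂) := by
    intro k hd h1 h2
    obtain ⟨i, hi'⟩ := hd (m i₁)
    have hmi1 : m i = m i₁ := hm (Finset.subset_insert _ _) (hmE i₁) hi'
    have hk := hi' k (Finset.mem_insert_self _ _)
    have hne₁ : i ≠ i₁ := by
      rintro rfl
      exact absurd h1 (not_lt.2 hk)
    have : i = i₂ := hj₁ _ _ hne₁ hi.symm (hmi1.trans hmi)
    subst this
    rw [hmi] at hk
    exact absurd h2 (not_lt.2 hk)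
  have hk₁' := (hk₁ k₁).2 rfl
  have hk₂' := (hk₂ k₂).2 rfl
  have hkk : k₁ ≠ k₂ := by
    rintro rfl
    exact hnot _ hk₁'.2.1 hk₁'.2.2 hk₂'.2.2
  have : (Finset.univ.filter fun k => k ∉ E ∧ IsDominating r (insert k E)) = {k₁, k₂} := by
    ext k
    simp only [Finset.mem_filter, Finset.mem_univ, true_and, Finset.mem_insert,
      Finset.mem_singleton]
    constructor
    · rintro ⟨h1, h2⟩
      exact (hor k h1 h2).imp (fun h => (hk₁ k).1 ⟨h1, h2, h⟩) (fun h => (hk₂ k).1 ⟨h1, h2, h⟩)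
    · rintro (rfl | rfl)
      · exact ⟨hk₁'.1, hk₁'.2.1⟩
      · exact ⟨hk₂'.1, hk₂'.2.1⟩
  rw [this, Finset.card_pair hkk]
  exact even_two

open Classical in
/-- Cardinal pivoting: if `b` is not a combination of fewer than `n` columns, a set with one column
too many has zero or two feasible subsets. -/
theorem even_card_erase_isFeasible {a : J → I → ℝ} {b : I → ℝ} (ha : ∀ j i, 0 ≤ a j i)
    (ha0 : ∀ j, ∃ i, 0 < a j i)
    (hgen : ∀ x : J → ℝ, ∑ j, x j • a j = b →
      Fintype.card I ≤ (Finset.univ.filter fun j => x j ≠ 0).card)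
    {E : Finset J} (hcard : E.card = Fintype.card I + 1) :
    Even (E.filter fun e => IsFeasible a b (E.erase e)).card := by
  by_cases hex : ∃ k ∈ E, IsFeasible a b (E.erase k)
  swap
  · push Not at hex
    rw [Finset.filter_false_of_mem hex]
    simp
  obtain ⟨k, hkE, x, hxpos, hx0, hxb⟩ := hex
  -- Genericity as nondegeneracy: a solution supported in the `n + 1` columns of `E` vanishes at no
  -- more than one of them.
  have hnz : ∀ y : J → ℝ, (∀ j ∉ E, y j = 0) → ∑ j, y j • a j = b →
      ∀ e ∈ E, ∀ e' ∈ E, y e = 0 → y e' = 0 → e = e' := by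
    intro y hy hyb e he e' he' h h'
    by_contra hne
    have h1 := hgen y hyb
    have h2 : (Finset.univ.filter fun j => y j ≠ 0) ⊆ (E.erase e).erase e' := by
      intro j hj
      simp only [Finset.mem_filter, Finset.mem_univ, true_and] at hj
      simp only [Finset.mem_erase]
      refine ⟨?_, ?_, ?_⟩
      · rintro rfl; exact hj h'
      · rintro rfl; exact hj h
      · by_contra h; exact hj (hy j h)
    have h3 := Finset.card_le_card h2
    rw [Finset.card_erase_of_mem (by simp [he', Ne.symm hne]), Finset.card_erase_of_mem he] at h3
    have : 0 < Fintype.card I := Fintype.card_pos_iff.2 ⟨(ha0 e).choose⟩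
    omega
  have hxE : ∀ j ∉ E, x j = 0 := fun j hj => hx0 j fun h => hj (Finset.mem_of_mem_erase h)
  have hxk : x k = 0 := hx0 k (by simp)
  -- Otherwise moving from `x` along `w` until coordinate `j` vanishes gives a solution with two
  -- zeros in `E`. Hence the solutions supported in `E` form a line `x + s z`.
  have hker : ∀ w : J → ℝ, (∀ j ∉ E, w j = 0) → ∑ j, w j • a j = 0 → w k = 0 → ∀ j, w j = 0 := by
    intro w hw hwb hwk j
    by_contra hj
    have hjE : j ∈ E := by
      by_contra h; exact hj (hw j h)
    have h1 := hnz (fun i => x i - (x j / w j) * w i)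
      (fun i hi => by simp [hxE i hi, hw i hi])
      (by
        simp only [sub_smul, mul_smul, Finset.sum_sub_distrib, ← Finset.smul_sum, hxb, hwb,
          smul_zero, sub_zero])
      j hjE k hkE (by field_simp; ring) (by simp [hxk, hwk])
    exact hj (h1 ▸ hwk)
  obtain ⟨z, hzE, hzb, hzk⟩ : ∃ z : J → ℝ, (∀ j ∉ E, z j = 0) ∧ ∑ j, z j • a j = 0 ∧ z k = 1 := by
    have hdep : ¬ LinearIndepOn ℝ a (E : Set J) := fun h => by
      have h1 := h.linearIndependent.fintype_card_le_finrank
      simp at h1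
      omega
    rw [linearIndepOn_finset_iff] at hdep
    push Not at hdep
    obtain ⟨g, hg, j₀, hj₀, hgj₀⟩ := hdep
    have hg0 : ∑ j, (if j ∈ E then g j else 0) • a j = 0 := by
      simpa [ite_smul, Finset.sum_ite_mem] using hg
    have hgk : g k ≠ 0 := fun h => by
      have := hker (fun j => if j ∈ E then g j else 0) (fun j hj => by simp [hj]) hg0
        (by simp [h]) j₀
      simp [hj₀, hgj₀] at this
    refine ⟨fun j => (g k)⁻¹ * (if j ∈ E then g j else 0), fun j hj => by simp [hj], ?_, ?_⟩
    · simp only [mul_smul, ← Finset.smul_sum, hg0, smul_zero]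
    · simp [hkE, hgk]
  -- As the columns are nonnegative and nonzero, the ray from `x` along `z` must leave the
  -- nonnegative orthant. The ratio test finds the exit point, the other end of the feasible
  -- segment; the two ends give the two feasible subsets.
  have hneg : ∃ e, z e < 0 := by
    by_contra! h
    obtain ⟨i, hi⟩ := ha0 k
    have h1 : ∑ j, z j * a j i = 0 := by simpa using congrFun hzb i
    have h2 := (Finset.sum_eq_zero_iff_of_nonneg (fun j _ => mul_nonneg (h j) (ha j i))).1 h1 k
      (Finset.mem_univ _)
    rw [hzk, one_mul] at h2
    exact hi.ne' h2
  obtain ⟨e, he, hemin⟩ := (Finset.univ.filter fun j => z j < 0).exists_min_image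
    (fun j => x j / (-z j)) (by obtain ⟨e, he⟩ := hneg; exact ⟨e, by simpa using he⟩)
  simp only [Finset.mem_filter, Finset.mem_univ, true_and] at he hemin
  have heE : e ∈ E := by
    by_contra h
    rw [hzE e h] at he
    exact lt_irrefl _ he
  have hek : e ≠ k := by
    rintro rfl
    rw [hzk] at he
    linarith
  have hxe : 0 < x e := hxpos e (by simp [hek, heE])
  set t := x e / (-z e) with ht
  have htpos : 0 < t := div_pos hxe (by linarith)
  have hze : z e ≠ 0 := he.ne
  have hte : x e + t * z e = 0 := by rw [ht]; field_simp; ring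
  have hxnn : ∀ j, 0 ≤ x j := fun j => by
    by_cases h : j ∈ E.erase k
    · exact (hxpos j h).le
    · exact (hx0 j h).ge
  have hynn : ∀ j, 0 ≤ x j + t * z j := fun j => by
    rcases lt_or_ge (z j) 0 with h | h
    · have := hemin j h
      rw [le_div_iff₀ (by linarith)] at this
      linarith
    · have := hxnn j
      positivity
  have hyE : ∀ j ∉ E, x j + t * z j = 0 := fun j hj => by simp [hxE j hj, hzE j hj]
  have hyb : ∑ j, (x j + t * z j) • a j = b := by
    simp only [add_smul, mul_smul, Finset.sum_add_distrib, ← Finset.smul_sum, hxb, hzb, smul_zero,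
      add_zero]
  have hy0 : ∀ j ∈ E, x j + t * z j = 0 → j = e := fun j hj h =>
    hnz (fun j => x j + t * z j) hyE hyb j hj e heE h hte
  have : (E.filter fun e => IsFeasible a b (E.erase e)) = {k, e} := by
    ext e'
    simp only [Finset.mem_filter, Finset.mem_insert, Finset.mem_singleton]
    constructor
    · rintro ⟨he'E, y, hypos, hyz, hyb'⟩
      by_cases hke' : e' = k
      · exact Or.inl hke'
      right
      have hyk : 0 < y k := hypos k (by simp [hkE, Ne.symm hke'])
      have hline : ∀ j, y j = x j + y k * z j := fun j => by
        have := hker (fun j => y j - x j - y k * z j) (fun j hj => by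
            simp [hxE j hj, hzE j hj, hyz j fun h => hj (Finset.mem_of_mem_erase h)]) (by
            simp only [sub_smul, mul_smul, Finset.sum_sub_distrib, ← Finset.smul_sum, hxb, hzb,
              hyb', smul_zero, sub_self]) (by simp [hxk, hzk]) j
        linarith
      have hye' : x e' + y k * z e' = 0 := by rw [← hline]; exact hyz e' (by simp)
      have hxe' : 0 < x e' := hxpos e' (by simp [hke', he'E])
      have hze' : z e' < 0 := by
        by_contra! h
        have := mul_nonneg hyk.le h
        linarith
      have hye : 0 ≤ x e + y k * z e := by
        rw [← hline]
        by_cases h : e ∈ E.erase e'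
        · exact (hypos e h).le
        · exact (hyz e h).ge
      have h1 : t ≤ y k := by
        have := hemin e' hze'
        rw [le_div_iff₀ (by linarith)] at this
        nlinarith
      have h2 : y k ≤ t := by
        nlinarith
      have h3 : y k = t := le_antisymm h2 h1
      rw [h3] at hye'
      exact hy0 e' he'E hye'
    · rintro (rfl | rfl)
      · exact ⟨hkE, x, hxpos, hx0, hxb⟩
      · refine ⟨heE, fun j => x j + t * z j, fun j hj => ?_, fun j hj => ?_, hyb⟩
        · rw [Finset.mem_erase] at hj
          exact lt_of_le_of_ne (hynn j) fun h => hj.1 (hy0 j hj.2 h.symm)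
        · by_cases h : j = e'
          · rw [h]; exact hte
          · exact hyE j fun h' => hj (by simp [h, h'])
  rw [this, Finset.card_pair hek.symm]
  exact even_two

end Scarf
-- Scarf's lemma by a parity count
section Scarf

variable {I K : Type*} [Fintype I] [Fintype K] [DecidableEq I] [DecidableEq K]

open Classical in
/-- All slack columns except `inl i₀` have exactly one completion to a dominating set. -/
theorem card_insert_isDominating_slack {r : I → I ⊕ K → ℕ} (hr : ∀ i, Function.Injective (r i))
    (hlow : ∀ i j, r i (.inl i) ≤ r i j)
    (htop : ∀ i i', i ≠ i' → ∀ k, r i (.inr k) < r i (.inl i')) (i₀ : I)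
    {E : Finset (I ⊕ K)} (hE : ∀ j, j ∈ E ↔ ∃ i, i ≠ i₀ ∧ j = .inl i) :
    (Finset.univ.filter fun k => k ∉ E ∧ IsDominating r (insert k E)).card = 1 := by
  have hi₀ : Sum.inl i₀ ∉ E := by simp [hE]
  -- A column outside `E` can be dominated only in row `i₀`: every other row has its lowest column,
  -- its own slack, in `E`.
  obtain ⟨k, hk, hmax⟩ := Eᶜ.exists_max_image (r i₀) ⟨.inl i₀, by simpa using hi₀⟩
  simp only [Finset.mem_compl] at hk hmax
  rw [Finset.card_eq_one]
  refine ⟨k, ?_⟩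
  ext q
  simp only [Finset.mem_filter, Finset.mem_univ, true_and, Finset.mem_singleton]
  constructor
  · rintro ⟨hqE, hq⟩
    obtain ⟨i, hi⟩ := hq k
    have : i = i₀ := by
      by_contra h
      have h1 := hi (.inl i) (Finset.mem_insert_of_mem ((hE _).2 ⟨i, h, rfl⟩))
      have h2 := hr _ (le_antisymm h1 (hlow i k))
      exact hk (h2 ▸ (hE _).2 ⟨i, h, rfl⟩)
    subst this
    exact hr _ (le_antisymm (hmax q hqE) (hi q (Finset.mem_insert_self _ _)))
  · rintro rfl
    refine ⟨hk, fun j => ?_⟩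
    by_cases hj : j ∈ E
    · obtain ⟨i, -, rfl⟩ := (hE j).1 hj
      exact ⟨i, fun d _ => hlow i d⟩
    · refine ⟨i₀, fun d hd => ?_⟩
      rcases Finset.mem_insert.1 hd with rfl | hd
      · exact hmax j hj
      · obtain ⟨i, hi, rfl⟩ := (hE d).1 hd
        rcases j with j | j
        · have : j = i₀ := by
            by_contra h
            exact hj ((hE _).2 ⟨j, h, rfl⟩)
          subst this
          exact hlow _ _
        · exact (htop _ _ hi.symm j).le

/-- **Scarf's lemma**, for a right-hand side `b` that is not a combination of fewer than `n`
columns. -/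
theorem exists_isFeasible_isDominating [Nonempty I] {r : I → I ⊕ K → ℕ}
    (hr : ∀ i, Function.Injective (r i)) (hlow : ∀ i j, r i (.inl i) ≤ r i j)
    (htop : ∀ i i', i ≠ i' → ∀ k, r i (.inr k) < r i (.inl i'))
    {a : I ⊕ K → I → ℝ} {b : I → ℝ} (ha : ∀ j i, 0 ≤ a j i) (ha0 : ∀ j, ∃ i, 0 < a j i)
    (hslack : ∀ i, a (.inl i) = Pi.single i 1) (hb : ∀ i, 0 < b i)
    (hgen : ∀ x : I ⊕ K → ℝ, ∑ j, x j • a j = b →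
      Fintype.card I ≤ (Finset.univ.filter fun j => x j ≠ 0).card) :
    ∃ D, IsFeasible a b D ∧ IsDominating r D := by
  classical
  by_contra! hcon
  obtain ⟨i₀⟩ := ‹Nonempty I›
  set n := Fintype.card I with hn
  have hnpos : 0 < n := Fintype.card_pos_iff.2 ⟨i₀⟩
  let Fs := (Finset.univ.powersetCard n).filter fun F : Finset (I ⊕ K) => IsFeasible a b F
  let Ds := (Finset.univ.powersetCard n).filter fun D : Finset (I ⊕ K) => IsDominating r D
  have hFs : ∀ F, F ∈ Fs ↔ F.card = n ∧ IsFeasible a b F := fun F => by simp [Fs]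
  have hDs : ∀ D, D ∈ Ds ↔ D.card = n ∧ IsDominating r D := fun D => by simp [Ds]
  -- Edges join feasible `F` to dominating `D`, both of size `n`. If no set is both, pivoting makes
  -- every degree even except that of the all-slack set, which is 1, so the edge count is both even
  -- and odd.
  let R : Finset (I ⊕ K) → Finset (I ⊕ K) → Prop := fun F D => F ⊆ insert (.inl i₀) D
  have hcount := Finset.sum_card_bipartiteAbove_eq_sum_card_bipartiteBelow (s := Fs) (t := Ds) R
  have hright : Even (∑ D ∈ Ds, (Fs.bipartiteBelow R D).card) := by
    refine Finset.even_sum _ fun D hD => ?_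
    obtain ⟨hDc, hDd⟩ := (hDs D).1 hD
    by_cases h0 : Sum.inl i₀ ∈ D
    · have : Fs.bipartiteBelow R D = ∅ := by
        refine Finset.filter_false_of_mem fun F hF hsub => ?_
        obtain ⟨hFc, hFf⟩ := (hFs F).1 hF
        simp only [R, Finset.insert_eq_of_mem h0] at hsub
        exact hcon D (Finset.eq_of_subset_of_card_le hsub (by omega) ▸ hFf) hDd
      simp [this]
    · have hc : (insert (Sum.inl i₀) D).card = n + 1 := by
        rw [Finset.card_insert_of_notMem h0, hDc]
      have : Fs.bipartiteBelow R D = ((insert (Sum.inl i₀) D).filter fun e =>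
          IsFeasible a b ((insert (Sum.inl i₀) D).erase e)).image
            fun e => (insert (Sum.inl i₀) D).erase e := by
        ext F
        simp only [Finset.bipartiteBelow, Finset.mem_filter, hFs, Finset.mem_image, R]
        constructor
        · rintro ⟨⟨hFc, hFf⟩, hsub⟩
          obtain ⟨e, he, heq⟩ := Finset.covBy_iff_exists_insert.1
            ((Finset.covBy_iff_card_sdiff_eq_one).2 ⟨hsub, by
              rw [Finset.card_sdiff_of_subset hsub]; omega⟩)
          have : (insert (Sum.inl i₀) D).erase e = F := by
            rw [← heq, Finset.erase_insert he]
          exact ⟨e, ⟨heq ▸ Finset.mem_insert_self _ _, this ▸ hFf⟩, this⟩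
        · rintro ⟨e, ⟨he, hf⟩, rfl⟩
          exact ⟨⟨by rw [Finset.card_erase_of_mem he]; omega, hf⟩, Finset.erase_subset _ _⟩
      rw [this, Finset.card_image_of_injOn]
      · exact even_card_erase_isFeasible ha ha0 hgen hc
      · exact (Finset.erase_injOn _).mono (by
          intro e he
          simp only [Finset.coe_filter, Set.mem_ofPred_eq] at he
          exact he.1)
  have hbelow : ∀ F, F.card = n → Sum.inl i₀ ∈ F → (Ds.bipartiteAbove R F).card =
      (Finset.univ.filter fun k => k ∉ F.erase (Sum.inl i₀) ∧
        IsDominating r (insert k (F.erase (Sum.inl i₀)))).card := by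
    intro F hFc h0
    have hEc := Finset.card_erase_of_mem h0
    have : Ds.bipartiteAbove R F = (Finset.univ.filter fun k => k ∉ F.erase (Sum.inl i₀) ∧
        IsDominating r (insert k (F.erase (Sum.inl i₀)))).image
          fun k => insert k (F.erase (Sum.inl i₀)) := by
      ext D
      simp only [Finset.bipartiteAbove, Finset.mem_filter, hDs, Finset.mem_image, R,
        Finset.mem_univ, true_and]
      rw [Finset.subset_insert_iff]
      constructor
      · rintro ⟨⟨hDc, hDd⟩, hsub⟩
        obtain ⟨k, hk, heq⟩ := Finset.covBy_iff_exists_insert.1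
          ((Finset.covBy_iff_card_sdiff_eq_one).2 ⟨hsub, by
            rw [Finset.card_sdiff_of_subset hsub]; omega⟩)
        exact ⟨k, ⟨hk, heq.symm ▸ hDd⟩, heq⟩
      · rintro ⟨k, ⟨hk, hd⟩, rfl⟩
        exact ⟨⟨by rw [Finset.card_insert_of_notMem hk]; omega, hd⟩, Finset.subset_insert _ _⟩
    rw [this, Finset.card_image_of_injOn]
    intro k hk k' hk' heq
    simp only [Finset.coe_filter, Set.mem_ofPred_eq, Finset.mem_univ, true_and] at hk hk'
    have h1 : k ∈ insert k' (F.erase (Sum.inl i₀)) := by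
      have : k ∈ insert k (F.erase (Sum.inl i₀)) := Finset.mem_insert_self _ _
      simpa only [← heq] using this
    exact (Finset.mem_insert.1 h1).resolve_right hk.1
  let S : Finset (I ⊕ K) := Finset.univ.map .inl
  have hSmem : ∀ j, j ∈ S ↔ ∃ i, Sum.inl i = j := fun j => by simp [S]
  have hSc : S.card = n := by simp [S, hn]
  have hSF : S ∈ Fs := by
    refine (hFs S).2 ⟨hSc, Sum.elim b 0, ?_, ?_, ?_⟩
    · simpa [S] using hb
    · rintro (i | k) hj
      · simp [S] at hj
      · rfl
    · ext i
      simp [hslack, Pi.single_apply, Fintype.sum_sum_type]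
  have hodd : (Ds.bipartiteAbove R S).card = 1 := by
    rw [hbelow S hSc (by simp [S])]
    refine card_insert_isDominating_slack hr hlow htop i₀ fun j => ?_
    simp only [Finset.mem_erase, hSmem]
    constructor
    · rintro ⟨hj, i, rfl⟩
      exact ⟨i, fun h => hj (h ▸ rfl), rfl⟩
    · rintro ⟨i, hi, rfl⟩
      exact ⟨fun h => hi (Sum.inl_injective h), i, rfl⟩
  rw [← hcount, ← Finset.add_sum_erase _ _ hSF, hodd] at hright
  have heven : Even (∑ F ∈ Fs.erase S, (Ds.bipartiteAbove R F).card) := by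
    refine Finset.even_sum _ fun F hF => ?_
    obtain ⟨hFS, hF⟩ := Finset.mem_erase.1 hF
    obtain ⟨hFc, hFf⟩ := (hFs F).1 hF
    by_cases h0 : Sum.inl i₀ ∈ F
    · rw [hbelow F hFc h0]
      -- A non-slack column in `F` ranks below the slack of `i₁` in every row other than `i₁`, so
      -- that slack is the candidate required for ordinal pivoting.
      obtain ⟨k, hk⟩ : ∃ k, Sum.inr k ∈ F := by
        by_contra! h
        refine hFS (Finset.eq_of_subset_of_card_le (fun j hj => ?_) (by omega))
        rcases j with i | k
        · exact (hSmem _).2 ⟨i, rfl⟩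
        · exact absurd hj (h k)
      have hkE : Sum.inr k ∈ F.erase (Sum.inl i₀) := by simpa using hk
      refine even_card_insert_isDominating hr ⟨_, hkE⟩ ?_ fun i₁ => ⟨.inl i₁,
        fun i hi => ⟨_, hkE, htop i i₁ hi k⟩⟩
      rw [Finset.card_erase_of_mem h0]
      omega
    · have : Ds.bipartiteAbove R F = ∅ := by
        refine Finset.filter_false_of_mem fun D hD hsub => ?_
        obtain ⟨hDc, hDd⟩ := (hDs D).1 hD
        simp only [R, Finset.subset_insert_iff_of_notMem h0] at hsub
        exact hcon D (Finset.eq_of_subset_of_card_le hsub (by omega) ▸ hFf) hDd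
      simp [this]
  rw [Nat.even_add] at hright
  exact absurd (hright.2 heven) (by decide)

end Scarf

/-! ### Generic right-hand sides and Hall's theorem -/

open MeasureTheory in
/-- Every nonempty open set contains a vector that is not a combination of fewer than `n` of
finitely many given columns. -/
theorem exists_mem_generic {I J : Type*} [Fintype I] [Fintype J] (a : J → I → ℝ) {U : Set (I → ℝ)}
    (hU : IsOpen U) (hne : U.Nonempty) :
    ∃ b ∈ U, ∀ x : J → ℝ, ∑ j, x j • a j = b →
      Fintype.card I ≤ (Finset.univ.filter fun j => x j ≠ 0).card := by
  classical
  -- A finite union of proper subspaces is Lebesgue-null, so it contains no nonempty open set.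
  let N : Set (I → ℝ) := ⋃ F ∈ {F : Finset J | F.card < Fintype.card I},
    (Submodule.span ℝ (F.image a : Set (I → ℝ)) : Set (I → ℝ))
  have hN : volume N = 0 := by
    refine (measure_biUnion_null_iff (Set.to_countable _)).2 fun F hF => ?_
    refine Measure.addHaar_submodule _ _ fun h => ?_
    have h1 := finrank_span_finset_le_card (R := ℝ) (F.image a)
    rw [Set.finrank, h, finrank_top, Module.finrank_fintype_fun_eq_card] at h1
    have h2 : F.card < Fintype.card I := hF
    have h3 := Finset.card_image_le (s := F) (f := a)
    omega
  obtain ⟨b, hb, hbN⟩ : ∃ b ∈ U, b ∉ N := by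
    by_contra! h
    exact (hU.measure_pos volume hne).ne' (measure_mono_null h hN)
  refine ⟨b, hb, fun x hx => ?_⟩
  by_contra! hlt
  refine hbN (Set.mem_biUnion hlt ?_)
  rw [SetLike.mem_coe, ← hx]
  refine Submodule.sum_mem _ fun j _ => ?_
  by_cases hj : x j = 0
  · simp [hj]
  · exact Submodule.smul_mem _ _ (Submodule.subset_span (by
      simp only [Finset.coe_image]; exact ⟨j, by simpa using hj, rfl⟩))

/-- A many-to-one form of Hall's theorem. -/
theorem exists_disjoint_subsets_card_eq {A O : Type*} [Fintype A] [DecidableEq A] [DecidableEq O]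
    (G : A → Finset O) (u : A → ℕ) (h : ∀ T : Finset A, ∑ i ∈ T, u i ≤ (T.biUnion G).card) :
    ∃ X : A → Finset O, (∀ i j, i ≠ j → Disjoint (X i) (X j)) ∧
      ∀ i, X i ⊆ G i ∧ (X i).card = u i := by
  -- Hall's theorem is applied to `u i` copies of each agent `i`.
  obtain ⟨f, hf, hfG⟩ := (Finset.all_card_le_biUnion_card_iff_exists_injective
    (fun p : Σ i, Fin (u i) => G p.1)).1 fun s => by
      have h1 : s ⊆ (s.image Sigma.fst).sigma fun _ => Finset.univ := fun p hp => by
        simp only [Finset.mem_sigma, Finset.mem_univ, and_true]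
        exact Finset.mem_image_of_mem _ hp
      have h2 := Finset.card_le_card h1
      rw [Finset.card_sigma] at h2
      simp only [Finset.card_univ, Fintype.card_fin] at h2
      rw [← Finset.image_biUnion]
      exact h2.trans (h _)
  refine ⟨fun i => Finset.univ.image fun t => f ⟨i, t⟩, fun i j hij => ?_, fun i => ⟨?_, ?_⟩⟩
  · rw [Finset.disjoint_left]
    simp only [Finset.mem_image, Finset.mem_univ, true_and, not_exists]
    rintro _ ⟨t, rfl⟩ t' h'
    exact hij (congrArg Sigma.fst (hf h')).symm
  · intro o ho
    simp only [Finset.mem_image, Finset.mem_univ, true_and] at ho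
    obtain ⟨t, rfl⟩ := ho
    exact hfG ⟨i, t⟩
  · rw [Finset.card_image_of_injective _ fun t t' h' => by simpa using hf h']
    simp

/-! ### From Scarf's lemma to the weak core -/

/-- Under dichotomous item preferences some allocation cannot be improved upon by any coalition. -/
theorem exists_allocation_forall_coalition {A O : Type*} [Fintype A] [Fintype O] [DecidableEq A]
    [DecidableEq O] (owner : O → A) (G : A → Finset O) :
    ∃ X : A → Finset O, (∀ i j, i ≠ j → Disjoint (X i) (X j)) ∧
      ∀ (S : Finset A) (Y : A → Finset O), S.Nonempty → (∀ i j, i ≠ j → Disjoint (Y i) (Y j)) →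
        (∀ i, ∀ o ∈ Y i, owner o ∈ S) → ∃ i ∈ S, (Y i ∩ G i).card ≤ (X i ∩ G i).card := by
  classical
  rcases isEmpty_or_nonempty A with hA | hA
  · exact ⟨fun _ => ∅, by simp, fun S Y hS => (hA.false hS.choose).elim⟩
  let K := {p : Finset A × (A → Finset O) // p.1.Nonempty ∧
    (∀ i j, i ≠ j → Disjoint (p.2 i) (p.2 j)) ∧ ∀ i, ∀ o ∈ p.2 i, owner o ∈ p.1}
  let S : A ⊕ K → Finset A := Sum.elim (fun i => {i}) fun k => k.1.1
  let Y : A ⊕ K → A → Finset O := Sum.elim (fun _ _ => ∅) fun k => k.1.2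
  have hSne : ∀ j, (S j).Nonempty := by
    rintro (i | k)
    · exact Finset.singleton_nonempty i
    · exact k.2.1
  have hYdisj : ∀ j i i', i ≠ i' → Disjoint (Y j i) (Y j i') := by
    rintro (i | k)
    · simp [Y]
    · exact k.2.2.1
  have hYS : ∀ j i, ∀ o ∈ Y j i, owner o ∈ S j := by
    rintro (i | k)
    · simp [Y]
    · exact k.2.2.2
  let v : A → A ⊕ K → ℕ := fun i j => (Y j i ∩ G i).card
  have hv : ∀ i j, v i j ≤ Fintype.card O := fun i j => Finset.card_le_univ _
  -- Row `i` ranks its own slack lowest, then the coalitions containing `i` by utility (values 1 to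
  -- `|O| + 1`), then the other coalitions, then the other slacks. `r` breaks ties by an enumeration
  -- of the columns.
  let c : A → A ⊕ K → ℕ := fun i => Sum.elim (fun i' => if i = i' then 0 else Fintype.card O + 3)
    fun k => if i ∈ S (.inr k) then v i (.inr k) + 1 else Fintype.card O + 2
  let N := Fintype.card (A ⊕ K)
  let r : A → A ⊕ K → ℕ := fun i j => c i j * N + Fintype.equivFin (A ⊕ K) j
  have hrlt : ∀ i j j', c i j < c i j' → r i j < r i j' := fun i j j' h => by
    have h1 := (Fintype.equivFin (A ⊕ K) j).2
    have h2 : (c i j + 1) * N ≤ c i j' * N := Nat.mul_le_mul_right _ h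
    simp only [r]
    rw [add_mul] at h2
    omega
  have hr : ∀ i, Function.Injective (r i) := fun i j j' h => by
    have h1 := congrArg (· % N) h
    simp only [r, Nat.mul_add_mod_self_right, N, Nat.mod_eq_of_lt (Fin.is_lt _)] at h1
    exact (Fintype.equivFin (A ⊕ K)).injective (Fin.ext h1)
  have hlow : ∀ i j, r i (.inl i) ≤ r i j := by
    intro i j
    by_cases h : j = .inl i
    · rw [h]
    · refine (hrlt _ _ _ ?_).le
      rcases j with i' | k
      · have : i ≠ i' := fun h' => h (h' ▸ rfl)
        simp [c, this]
      · simp only [c, Sum.elim_inl, Sum.elim_inr, if_true]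
        split_ifs <;> omega
  have htop : ∀ i i', i ≠ i' → ∀ k, r i (.inr k) < r i (.inl i') := by
    intro i i' hii k
    refine hrlt _ _ _ ?_
    have := hv i (.inr k)
    simp only [c, Sum.elim_inl, Sum.elim_inr, if_neg hii]
    split_ifs <;> omega
  let a : A ⊕ K → A → ℝ := fun j i => if i ∈ S j then 1 else 0
  have ha : ∀ j i, 0 ≤ a j i := fun j i => by simp only [a]; split_ifs <;> norm_num
  have ha0 : ∀ j, ∃ i, 0 < a j i := fun j => by
    obtain ⟨i, hi⟩ := hSne j
    exact ⟨i, by simp [a, hi]⟩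
  have hslack : ∀ i, a (.inl i) = Pi.single i 1 := fun i => by
    ext i'
    simp [a, S, Pi.single_apply]
  -- `M` bounds the sum of all utilities. With `b` within `1 / (M + 1)` of 1, replacing weights 1 by
  -- `b` loses less than one object in total.
  set M : ℝ := Fintype.card A * Fintype.card O with hM
  have hMnn : 0 ≤ M := by positivity
  obtain ⟨b, hbU, hgen⟩ := exists_mem_generic a
    (U := Set.pi Set.univ fun _ => Set.Ioo (1 - 1 / (M + 1)) 1)
    (isOpen_set_pi Set.finite_univ fun _ _ => isOpen_Ioo)
    (Set.univ_pi_nonempty_iff.2 fun _ => Set.nonempty_Ioo.2 (by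
      have : 0 < 1 / (M + 1) := by positivity
      linarith))
  have hb1 : ∀ i, b i ≤ 1 := fun i => (hbU i trivial).2.le
  have hbε : ∀ i, 1 - 1 / (M + 1) < b i := fun i => (hbU i trivial).1
  have hb : ∀ i, 0 < b i := fun i => by
    have : 1 / (M + 1) ≤ 1 := by rw [div_le_one (by positivity)]; linarith
    linarith [hbε i]
  obtain ⟨D, ⟨x, hxpos, hx0, hxb⟩, hD⟩ :=
    exists_isFeasible_isDominating hr hlow htop ha ha0 hslack hb hgen
  have hxnn : ∀ j, 0 ≤ x j := fun j => by
    by_cases h : j ∈ D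
    · exact (hxpos j h).le
    · exact (hx0 j h).ge
  have hxb' : ∀ i, b i = ∑ j, x j * a j i := fun i => by simp [← hxb]
  have hcover : ∀ i, (D.filter fun j => i ∈ S j).Nonempty := fun i => by
    by_contra h
    rw [Finset.not_nonempty_iff_eq_empty, Finset.filter_eq_empty_iff] at h
    refine (hb i).ne' ?_
    rw [hxb']
    refine Finset.sum_eq_zero fun j _ => ?_
    by_cases hj : j ∈ D
    · simp [a, h hj]
    · simp [hx0 j hj]
  choose w hw hwmin using fun i => Finset.exists_min_image _ (v i) (hcover i)
  simp only [Finset.mem_filter] at hw hwmin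
  obtain ⟨X, hXdisj, hX⟩ := exists_disjoint_subsets_card_eq G (fun i => v i (w i)) fun T => by
    -- Within one column, the acceptable objects received by agents of `T` are distinct and owned by
    -- the coalition.
    have hinner : ∀ j, ∑ i ∈ T, a j i * (v i j : ℝ) ≤ ∑ o ∈ T.biUnion G, a j (owner o) := by
      intro j
      calc ∑ i ∈ T, a j i * (v i j : ℝ) ≤ ∑ i ∈ T, (v i j : ℝ) := by
            refine Finset.sum_le_sum fun i _ => ?_
            simp only [a]
            split_ifs <;> simp
        _ = ((T.biUnion fun i => Y j i ∩ G i).card : ℝ) := by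
            rw [Finset.card_biUnion fun i _ i' _ h => (hYdisj j i i' h).mono
              Finset.inter_subset_left Finset.inter_subset_left]
            push_cast
            rfl
        _ ≤ (((T.biUnion G).filter fun o => owner o ∈ S j).card : ℝ) := by
            refine Nat.cast_le.2 (Finset.card_le_card fun o ho => ?_)
            simp only [Finset.mem_biUnion, Finset.mem_inter, Finset.mem_filter] at ho ⊢
            obtain ⟨i, hi, hoY, hoG⟩ := ho
            exact ⟨⟨i, hi, hoG⟩, hYS j i o hoY⟩
        _ = ∑ o ∈ T.biUnion G, a j (owner o) := by simp [a]
    have hweighted : ∑ i ∈ T, b i * (v i (w i) : ℝ) ≤ (T.biUnion G).card := by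
      calc ∑ i ∈ T, b i * (v i (w i) : ℝ) ≤ ∑ i ∈ T, ∑ j, x j * (a j i * (v i j : ℝ)) := by
            refine Finset.sum_le_sum fun i _ => ?_
            rw [hxb', Finset.sum_mul]
            refine Finset.sum_le_sum fun j _ => ?_
            rw [mul_assoc]
            by_cases hj : j ∈ D
            · refine mul_le_mul_of_nonneg_left ?_ (hxnn j)
              by_cases hi : i ∈ S j
              · exact mul_le_mul_of_nonneg_left (Nat.cast_le.2 (hwmin i j ⟨hj, hi⟩)) (ha j i)
              · simp [a, hi]
            · simp [hx0 j hj]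
        _ = ∑ j, x j * ∑ i ∈ T, a j i * (v i j : ℝ) := by
            rw [Finset.sum_comm]
            simp only [Finset.mul_sum]
        _ ≤ ∑ j, x j * ∑ o ∈ T.biUnion G, a j (owner o) :=
            Finset.sum_le_sum fun j _ => mul_le_mul_of_nonneg_left (hinner j) (hxnn j)
        _ = ∑ o ∈ T.biUnion G, b (owner o) := by
            simp only [Finset.mul_sum, hxb']
            rw [Finset.sum_comm]
        _ ≤ ∑ o ∈ T.biUnion G, (1 : ℝ) := Finset.sum_le_sum fun o _ => hb1 _
        _ = (T.biUnion G).card := by simp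
    have hbound : ∑ i ∈ T, (1 - b i) * (v i (w i) : ℝ) ≤ 1 / (M + 1) * M := by
      calc ∑ i ∈ T, (1 - b i) * (v i (w i) : ℝ)
          ≤ ∑ i ∈ T, 1 / (M + 1) * (Fintype.card O : ℝ) := by
            refine Finset.sum_le_sum fun i _ => mul_le_mul ?_ (Nat.cast_le.2 (hv _ _))
              (Nat.cast_nonneg _) (by positivity)
            linarith [hbε i]
        _ ≤ ∑ i : A, 1 / (M + 1) * (Fintype.card O : ℝ) :=
            Finset.sum_le_sum_of_subset_of_nonneg (Finset.subset_univ _)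
              fun _ _ _ => by positivity
        _ = 1 / (M + 1) * M := by
            rw [Finset.sum_const, Finset.card_univ, nsmul_eq_mul, hM]
            ring
    have hsmall : 1 / (M + 1) * M < 1 := by
      rw [div_mul_eq_mul_div, div_lt_one (by positivity)]
      linarith
    have hsum : (∑ i ∈ T, (v i (w i) : ℝ)) < (T.biUnion G).card + 1 := by
      have : ∑ i ∈ T, (v i (w i) : ℝ) =
          ∑ i ∈ T, (1 - b i) * (v i (w i) : ℝ) + ∑ i ∈ T, b i * (v i (w i) : ℝ) := by
        rw [← Finset.sum_add_distrib]
        exact Finset.sum_congr rfl fun i _ => by ring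
      linarith
    exact Nat.lt_succ_iff.1 (by exact_mod_cast hsum)
  refine ⟨X, hXdisj, fun S' Y' hS' hY' hown => ?_⟩
  obtain ⟨i, hi⟩ := hD (.inr ⟨(S', Y'), hS', hY', hown⟩)
  have hle : c i (.inr ⟨(S', Y'), hS', hY', hown⟩) ≤ c i (w i) := by
    by_contra! h
    exact absurd (hrlt _ _ _ h) (not_lt.2 (hi _ (hw i).1))
  -- Strict only for the slack of `i`, where `c` and `v` are both 0.
  have hcw : ∀ j, i ∈ S j → c i j ≤ v i j + 1 := by
    rintro (i' | k) h
    · have : i = i' := by simpa [S] using h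
      simp [c, this]
    · simp [c, h]
  have hle := hle.trans (hcw _ (hw i).2)
  have hvw := hv i (w i)
  simp only [c, Sum.elim_inr] at hle
  -- The dominating row belongs to a member of the coalition: for a non-member the rank value `|O| +
  -- 2` exceeds `v i (w i) + 1`.
  by_cases hiS : i ∈ S (.inr ⟨(S', Y'), hS', hY', hown⟩)
  · rw [if_pos hiS] at hle
    refine ⟨i, hiS, ?_⟩
    rw [Finset.inter_eq_left.2 (hX i).1, (hX i).2]
    exact Nat.le_of_succ_le_succ hle
  · rw [if_neg hiS] at hle
    omega

theorem theorem1 {A O : Type*} [Finite A] [Finite O] [DecidableEq O]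
    (E : Economy A O) (hE : E.HasDichotomousItemPreferences) :
    E.weakCore.Nonempty := by
  classical
  have := Fintype.ofFinite A
  have := Fintype.ofFinite O
  choose G hG using hE
  choose owner howner using E.endowment_cover
  have huniq : ∀ o j, o ∈ E.endowment j → owner o = j := fun o j hj => by
    by_contra h
    exact Finset.disjoint_left.1 (E.endowment_disjoint _ _ h) (howner o) hj
  obtain ⟨X, hXdisj, hX⟩ := exists_allocation_forall_coalition owner G
  refine ⟨X, hXdisj, fun S hS => ?_⟩
  rintro ⟨Y, ⟨hYdisj, hYS⟩, hlt⟩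
  obtain ⟨i, hi, hle⟩ := hX S (fun i => if h : i ∈ S then Y ⟨i, h⟩ else ∅) hS (fun i j hij => by
      by_cases hi : i ∈ S
      · by_cases hj : j ∈ S
        · simpa [hi, hj] using hYdisj ⟨i, hi⟩ ⟨j, hj⟩ (by simpa using hij)
        · simp [hj]
      · simp [hi]) (fun i o ho => by
      by_cases hi : i ∈ S
      · simp only [hi, dif_pos] at ho
        obtain ⟨j, hj, hoj⟩ := hYS ⟨i, hi⟩ o ho
        exact huniq o j hoj ▸ hj
      · simp [hi] at ho)
  have h := hlt ⟨i, hi⟩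
  rw [hG, hG, WithBot.coe_lt_coe, Nat.cast_lt] at h
  simp only [hi, dif_pos] at hle
  exact absurd hle (not_le.2 h)
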